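/- **Setting.** Let $\ell,m\ge 1$ and $n\ge 0$ be integers, let $\nu=(\nu_1,\dots,\nu_\ell)\in\mathbb N^\ell$ with $\sum_p\nu_p=m$, let $\kappa\in\mathbb C\setminus\mathbb Q_{\ge 0}$, $c=\kappa-m$, and let $\varepsilon$ be a primitive $\ell$-th root of unity. Put $$h=\frac1\kappa,\qquad h_p=\frac{\nu^\bullet_p}{\kappa}-\frac{m}{\ell\kappa}\ (1\le p\le \ell),\qquad \nu^\bullet=(\nu_{\ell-1},\dots,\nu_1,\nu_\ell),\qquad H=(h_1,\dots,h_{\ell-1}).$$ Let $\mathcal P_n^\ell$ be the set of $\ell$-partitions $\lambda=(\lambda_1,\dots,\lambda_\ell)$ of $n$, let $\mathcal P^\ell_{n,\nu}$ be the subset of those for which $\lambda_p$ has at most $\nu_p$ parts for every $p$, and put $\lambda^\circ=(\lambda_\ell,\dots,\lambda_1)$. **The order $\trianglelefteq$.** Let $\{1,\dots,m\}=J_1\sqcup\dots\sqcup J_\ell$ be the partition into consecutive segments with $|J_p|=\nu_p$. The affine weights of $\widehat{\mathfrak{gl}}_m$ are the vectors $a\delta+\sum_i x_i\epsilon_i+b\omega_0$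 with $a,x_i,b\in\mathbb C$, with the symmetric bilinear form such that $\langle\omega_0:\delta\rangle=1$, $\langle\epsilon_i:\epsilon_j\rangle=\delta_{ij}$, and the other pairings of basis vectors vanish. Put $\rho=(m,\dots,2,1)$ and $\hat\rho=\rho+m\omega_0$. The positive real roots are the $\epsilon_i-\epsilon_j+k\delta$ with $i\ne j$, $k\in\mathbb Z$ and either $k>0$, or $k=0$ and $i<j$; the positive roots are these and the $k\delta$ with $k>0$. Let $\Pi_\nu$ be the set of the $\epsilon_i-\epsilon_j$ with $i\neq j$ in the same segment, $\Pi_\nu^+$ its positive part, and $\mathfrak S_\nu$ the group of permutations of $\{1,\dots,m\}$ that preserve every segment, acting on the $\epsilon_i$. Write $w\bullet x=w(x+\hat\rho)-\hat\rho$, where $w\in\mathfrak S_\nu$ or $w$ is the reflection $s_\alpha$ in a real root $\alpha$. An affine weight $x$ is $\nu$-dominant if $x_i-x_{i+1}\in\mathbb N$ whenever $i,i+1$ lie in the same segment, and $\nu$-regular if $\langle x:\alpha\rangle\ne0$ for all $\alpha\in\Pi_\nu$. Write $x<y$ if $y-x$ is a nonzero sum of positive roots. For $\nu$-dominant $x,y$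 write $x\uparrow y$ if $x<y$ and there is a positive real root $\alpha\notin\Pi_\nu^+$ such that $\langle y+\hat\rho:\alpha\rangle\in\mathbb Z_{>0}$, $s_\alpha\bullet y+\hat\rho$ is $\nu$-regular, and $x=w\bullet(s_\alpha\bullet y)$ for some $w\in\mathfrak S_\nu$. Let $\trianglelefteq$ be the reflexive and transitive closure of $\uparrow$. View $\lambda\in\mathcal P^\ell_{n,\nu}$ as an element of $\mathbb N^m$ whose entries on $J_p$ are the parts of $\lambda_p$ completed by zeros. Let $\pi\in\mathbb C^m$ have all its entries on $J_p$ equal to $-cp/\ell$, and put $\lambda_\pi=\lambda+\pi$ and $$\tilde\lambda_\pi=\lambda_\pi+c\,\omega_0-\frac{\langle\lambda_\pi:2\rho+\lambda_\pi\rangle}{2\kappa}\,\delta .$$ Let $\Delta_{\lambda,\nu,\kappa}$ be the parabolic Verma module with highest weight $\lambda_\pi+c\omega_0$. The modules $\Delta_{\lambda,\nu,\kappa}$ are ordered by their (lifted) highest weights: $\Delta_{\mu,\nu,\kappa}\trianglelefteq\Delta_{\lambda,\nu,\kappa}$ means $\tilde\mu_\pi\trianglelefteq\tilde\lambda_\pi$.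 **The order $\preccurlyeq$.** Let $D_\ell\subset\mathbb C^\times$ be the group of $\ell$-th roots of unity, $W=\mathfrak S_n\ltimes (D_\ell)^n$, let $\varepsilon_i\in (D_\ell)^n$ have $i$-th entry $\varepsilon$ and other entries $1$, and put $s_{i,j}^{(p)}=s_{i,j}\varepsilon_i^p\varepsilon_j^{-p}$. For $\lambda\in\mathcal P_n^\ell$ let $\mathfrak X_\lambda$ be the simple $\mathbb CW$-module induced from $\bigotimes_p \mathfrak X_{\lambda_p}\chi_{p-1}^{\otimes|\lambda_p|}$ over $\prod_p(\mathfrak S_{|\lambda_p|}\ltimes (D_\ell)^{|\lambda_p|})$, where $\mathfrak X_{\lambda_p}$ is the Specht module of $\lambda_p$ (trivial if $\lambda_p$ has one row) and $\chi_q(\varepsilon)=\varepsilon^q$. Let $\theta_\lambda$ be the scalar by which $$\mathrm{eu}_0=-h\sum_{i<j}\sum_{p=1}^{\ell}\bigl(1-s_{i,j}^{(p)}\bigr)+\sum_{i=1}^n\sum_{p,p'=1}^{\ell-1}\varepsilon^{-pp'}(h_1+\dots+h_{p'})\,\varepsilon_i^p\ \in\ \mathbb CW$$ acts on $\mathfrak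 X_\lambda$. Let $\Delta_{\lambda,h,H}$, $\lambda\in\mathcal P_n^\ell$, be the standard modules of category $\mathcal O$ of the cyclotomic rational double affine Hecke algebra (CRDAHA) with parameters $h,H$, i.e. the modules induced from $\mathfrak X_\lambda$. They are ordered by $$\Delta_{\mu,h,H}\preccurlyeq\Delta_{\lambda,h,H}\iff \mu=\lambda\ \text{ or }\ \theta_\mu-\theta_\lambda\in\mathbb Z_{>0}.$$ **Proposition 6.4.** Let $\lambda,\mu\in\mathcal P^\ell_{n,\nu}$. If $\Delta_{\mu,\nu,\kappa}\trianglelefteq\Delta_{\lambda,\nu,\kappa}$, then $\Delta_{\mu^\circ,h,H}\preccurlyeq\Delta_{\lambda^\circ,h,H}$. -/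

import Mathlib

/-! ## `ℓ`-partitions

Partitions are Young diagrams; `Λ = {1, …, ℓ}` is `Fin ℓ`, with `p : Fin ℓ` standing for `p + 1`. -/

/-- The set `𝒫_n^ℓ` of `ℓ`-partitions of `n`. -/
structure MultiPartition (ℓ n : ℕ) where
  parts : Fin ℓ → YoungDiagram
  card_eq : ∑ p, (parts p).card = n

namespace MultiPartition

variable {ℓ n : ℕ}

/-- The subset `𝒫_{n,ν}^ℓ`: the `p`-th partition has at most `ν_p` parts. -/
def LengthLE (lam : MultiPartition ℓ n) (ν : Fin ℓ → ℕ) : Prop :=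
  ∀ p, (lam.parts p).colLen 0 ≤ ν p

/-- `λ° = (λ_ℓ, …, λ_2, λ_1)`. -/
def rev (lam : MultiPartition ℓ n) : MultiPartition ℓ n where
  parts p := lam.parts p.rev
  card_eq :=
    (Equiv.sum_comp Fin.revPerm (fun p => (lam.parts p).card)).trans lam.card_eq

/-- The boxes of an `ℓ`-partition: a component together with a cell of its Young diagram. -/
abbrev Box (lam : MultiPartition ℓ n) : Type :=
  (p : Fin ℓ) × {c : ℕ × ℕ // c ∈ (lam.parts p).cells}

/-- A tableau of shape `λ`: a filling of the boxes by `Fin n`. -/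
noncomputable def tableau (lam : MultiPartition ℓ n) : Fin n ≃ lam.Box :=
  (Fintype.equivFinOfCardEq (by
    rw [Fintype.card_sigma]
    exact (Finset.sum_congr rfl fun p _ => Fintype.card_coe _).trans lam.card_eq)).symm

end MultiPartition

/-! ## The affine side: weights of affine `gl_m` and the parabolic order -/

namespace AffineO

variable {ℓ : ℕ}

/-- `J = J_{ν,1} ⊔ … ⊔ J_{ν,ℓ}`; `⟨p, i⟩` is the `i`-th element of the `p`-th block. -/
abbrev J (ν : Fin ℓ → ℕ) : Type := (p : Fin ℓ) × Fin (ν p)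

/-- `m = ν_1 + ⋯ + ν_ℓ`. -/
def size (ν : Fin ℓ → ℕ) : ℕ := ∑ p, ν p

/-- The position, from `0` to `m - 1`, of an element of `J` in `{1, …, m}`. -/
def pos {ν : Fin ℓ → ℕ} (j : J ν) : ℕ := (∑ q with q < j.1, ν q) + j.2

/-- Affine weights: `(a, x, b)` is `a δ + ∑ x_j ε_j + b ω₀`. -/
abbrev AffWt (ν : Fin ℓ → ℕ) : Type := ℂ × (J ν → ℂ) × ℂ

variable (ν : Fin ℓ → ℕ)

/-- The symmetric bilinear form with `⟨ω₀ : δ⟩ = 1`, `⟨ε_i : ε_j⟩ = δ_{ij}`, all others `0`. -/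
def form {ν : Fin ℓ → ℕ} (x y : AffWt ν) : ℂ :=
  x.1 * y.2.2 + x.2.2 * y.1 + ∑ j, x.2.1 j * y.2.1 j

/-- `ρ = (m, …, 2, 1)`. -/
def rho : J ν → ℂ := fun j => (size ν : ℂ) - (pos j : ℂ)

/-- `ρ̂ = ρ + m ω₀`. -/
def rhoHat : AffWt ν := (0, rho ν, (size ν : ℂ))

/-- `ε_i - ε_j + k δ`. -/
def rootVec {ν : Fin ℓ → ℕ} (i j : J ν) (k : ℤ) : AffWt ν :=
  ((k : ℂ), Pi.single i 1 - Pi.single j 1, 0)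

/-- The positive real affine roots. -/
def posRealRoots : Set (AffWt ν) :=
  {α | ∃ i j : J ν, ∃ k : ℤ, i ≠ j ∧ (0 < k ∨ (k = 0 ∧ pos i < pos j)) ∧ α = rootVec i j k}

/-- The positive affine roots: the real ones and the multiples `k δ`, `k > 0`. -/
def posRoots : Set (AffWt ν) :=
  posRealRoots ν ∪ {α | ∃ k : ℤ, 0 < k ∧ α = ((k : ℂ), 0, 0)}

/-- The roots `Π_ν` of the Levi subalgebra `gl_{ν_1} ⊕ ⋯ ⊕ gl_{ν_ℓ}`. -/
def leviRoots : Set (AffWt ν) :=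
  {α | ∃ i j : J ν, i ≠ j ∧ i.1 = j.1 ∧ α = rootVec i j 0}

/-- The positive roots `Π_ν⁺`. -/
def leviPosRoots : Set (AffWt ν) :=
  {α | ∃ i j : J ν, pos i < pos j ∧ i.1 = j.1 ∧ α = rootVec i j 0}

/-- The reflection `s_α` of a real root (`⟨α : α⟩ = 2`). -/
def reflect {ν : Fin ℓ → ℕ} (α x : AffWt ν) : AffWt ν := x - form x α • α

/-- The dot action `s_α • x`. -/
def dotReflect {ν : Fin ℓ → ℕ} (α x : AffWt ν) : AffWt ν :=
  reflect α (x + rhoHat ν) - rhoHat ν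

/-- The Weyl group `𝔖_ν` of the Levi subalgebra: permutations of `J` that preserve each block. -/
def leviWeyl : Set (Equiv.Perm (J ν)) := {w | ∀ j, (w j).1 = j.1}

/-- The linear action of permutations of `J`: `w(ε_j) = ε_{w j}`, `w(δ) = δ`, `w(ω₀) = ω₀`. -/
def permute {ν : Fin ℓ → ℕ} (w : Equiv.Perm (J ν)) (x : AffWt ν) : AffWt ν :=
  (x.1, fun j => x.2.1 (w.symm j), x.2.2)

/-- The dot action `w • x`. -/
def dotPermute {ν : Fin ℓ → ℕ} (w : Equiv.Perm (J ν)) (x : AffWt ν) : AffWt ν :=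
  permute w (x + rhoHat ν) - rhoHat ν

/-- `ν`-dominance: `x_i - x_{i+1} ∈ ℕ` whenever `i`, `i + 1` are in the same block. -/
def IsDominant {ν : Fin ℓ → ℕ} (x : AffWt ν) : Prop :=
  ∀ i j : J ν, i.1 = j.1 → pos j = pos i + 1 → ∃ k : ℕ, x.2.1 i - x.2.1 j = k

/-- `ν`-regularity. -/
def IsRegular {ν : Fin ℓ → ℕ} (x : AffWt ν) : Prop := ∀ α ∈ leviRoots ν, form x α ≠ 0

/-- `y = x_+`: `y` is `ν`-dominant and in the dot-orbit of `x` under `𝔖_ν`. -/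
def IsPlus {ν : Fin ℓ → ℕ} (x y : AffWt ν) : Prop :=
  IsDominant y ∧ ∃ w ∈ leviWeyl ν, y = dotPermute w x

/-- `x < y`: `y - x` is a nonzero sum of positive affine roots. -/
def WtLT {ν : Fin ℓ → ℕ} (x y : AffWt ν) : Prop :=
  y - x ∈ AddSubmonoid.closure (posRoots ν) ∧ x ≠ y

/-- The relation `x ↑ y` on `ν`-dominant affine weights. -/
def Up {ν : Fin ℓ → ℕ} (x y : AffWt ν) : Prop :=
  IsDominant x ∧ IsDominant y ∧ ∃ α ∈ posRealRoots ν \ leviPosRoots ν,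
    (∃ k : ℕ, 0 < k ∧ form (y + rhoHat ν) α = k) ∧
    IsRegular (dotReflect α y + rhoHat ν) ∧ IsPlus (dotReflect α y) x ∧ WtLT x y

/-- The order `x ⊴ y`: reflexive and transitive closure of `↑`. -/
def TriLE {ν : Fin ℓ → ℕ} (x y : AffWt ν) : Prop := Relation.ReflTransGen Up x y

/-- The level `c = κ - m`. -/
def level (κ : ℂ) : ℂ := κ - (size ν : ℂ)

/-- `π = (c / ℓ) (-1, …, -1, -2, …, -ℓ)`, where `-p` has multiplicity `ν_p`. -/
noncomputable def shift (κ : ℂ) : J ν → ℂ :=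
  fun j => level ν κ / (ℓ : ℂ) * (-((j.1 : ℕ) + 1 : ℂ))

/-- `x̃ = x + c ω₀ + z_x δ`, where `z_x = -⟨x : 2ρ + x⟩ / 2κ`. -/
noncomputable def tilde (κ : ℂ) (x : J ν → ℂ) : AffWt ν :=
  (-(∑ j, x j * (2 * rho ν j + x j)) / (2 * κ), x, level ν κ)

/-- An `ℓ`-partition in `𝒫_{n,ν}^ℓ` as a weight: the parts of `λ_p`, completed by zeros, are the
entries in the `p`-th block. -/
def toWeight {n : ℕ} (lam : MultiPartition ℓ n) : J ν → ℂ :=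
  fun j => ((lam.parts j.1).rowLen j.2 : ℂ)

/-- The order `Δ_{μ,ν,κ} ⊴ Δ_{λ,ν,κ}` on parabolic Verma modules, which is by definition the order
`⊴` of their highest weights; the highest weight of `Δ_{λ,ν,κ}`, in the category of modules over
the affine Lie algebra extended by the derivation, is that of `λ + π` lifted by `tilde`. -/
def StdLE (κ : ℂ) {n : ℕ} (mu lam : MultiPartition ℓ n) : Prop :=
  TriLE (tilde ν κ (toWeight ν mu + shift ν κ)) (tilde ν κ (toWeight ν lam + shift ν κ))

end AffineO

/-! ## The CRDAHA side: the group `G(ℓ,1,n)`, its irreducible modules, and the order -/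

namespace CRDAHA

variable {ℓ n : ℕ}

/-- `W = 𝔖_n ⋉ (D_ℓ)^n`, with `D_ℓ` the group of complex `ℓ`-th roots of unity. -/
abbrev W (ℓ n : ℕ) : Type :=
  (Fin n → rootsOfUnity ℓ ℂ) ⋊[mulAutArrow] Equiv.Perm (Fin n)

/-- The group algebra `ℂW`. -/
abbrev CW (ℓ n : ℕ) : Type := MonoidAlgebra ℂ (W ℓ n)

/-- A permutation, as an element of `ℂW`. -/
noncomputable def perm (σ : Equiv.Perm (Fin n)) : CW ℓ n :=
  MonoidAlgebra.of ℂ (W ℓ n) (SemidirectProduct.inr σ)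

/-- A tuple of roots of unity, as an element of `ℂW`. -/
noncomputable def diag (d : Fin n → rootsOfUnity ℓ ℂ) : CW ℓ n :=
  MonoidAlgebra.of ℂ (W ℓ n) (SemidirectProduct.inl d)

/-- `s_{i,j}^{(p)} = s_{i,j} ε_i^p ε_j^{-p}`. -/
noncomputable def refl (ε : rootsOfUnity ℓ ℂ) (i j : Fin n) (p : ℕ) : CW ℓ n :=
  perm (Equiv.swap i j) * diag (Pi.mulSingle i (ε ^ p) * Pi.mulSingle j (ε ^ p)⁻¹)

/-- The degree zero part of the Euler element of the algebra with parameters `h`, `H`: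
`-h ∑_{i<j} ∑_p (1 - s_{i,j}^{(p)}) + ∑_i ∑_{p,p'=1}^{ℓ-1} ε^{-pp'} (h_1 + ⋯ + h_{p'}) ε_i^p`. -/
noncomputable def eu0 (ε : rootsOfUnity ℓ ℂ) (h : ℂ) (H : Fin ℓ → ℂ) : CW ℓ n :=
  -h • (∑ i : Fin n, ∑ j : Fin n with i < j, ∑ p ∈ Finset.range ℓ, (1 - refl ε i j p)) +
    ∑ i : Fin n, ∑ p ∈ Finset.Icc 1 (ℓ - 1), ∑ p' ∈ Finset.Icc 1 (ℓ - 1),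
      ((((ε : ℂˣ) : ℂ)⁻¹) ^ (p * p') * ∑ q : Fin ℓ with q.val < p', H q) •
        diag (Pi.mulSingle i (ε ^ p))

/-- The sum of the permutations preserving the rows of the tableau. -/
noncomputable def rowSym (lam : MultiPartition ℓ n) : CW ℓ n :=
  ∑ σ : Equiv.Perm (Fin n) with ∀ k,
    (lam.tableau (σ k)).1 = (lam.tableau k).1 ∧
      (lam.tableau (σ k)).2.1.1 = (lam.tableau k).2.1.1, perm σ

/-- The signed sum of the permutations preserving the columns of the tableau. -/
noncomputable def colAntisym (lam : MultiPartition ℓ n) : CW ℓ n :=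
  ∑ σ : Equiv.Perm (Fin n) with ∀ k,
    (lam.tableau (σ k)).1 = (lam.tableau k).1 ∧
      (lam.tableau (σ k)).2.1.2 = (lam.tableau k).2.1.2,
    ((Equiv.Perm.sign σ : ℤ) : ℂ) • perm σ

/-- The idempotent of `(D_ℓ)^n` for the character which is `χ_{p-1} : ε ↦ ε^{p-1}` on the factors
filling the boxes of the `p`-th component. -/
noncomputable def charIdem (ε : rootsOfUnity ℓ ℂ) (lam : MultiPartition ℓ n) : CW ℓ n :=
  ((ℓ : ℂ) ^ n)⁻¹ • ∑ a : Fin n → Fin ℓ,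
    (∏ k, (((ε : ℂˣ) : ℂ)⁻¹) ^ ((a k : ℕ) * ((lam.tableau k).1 : ℕ))) •
      diag (fun k => ε ^ (a k : ℕ))

/-- The simple `W`-module `𝔛_λ = Ind_{W_μ}^W (⊗_p 𝔛_{λ_p} χ_{p-1}^{⊗ |λ_p|})`, where `W_μ` is the
product over `p` of the groups `G(ℓ,1,|λ_p|)` and `𝔛_{λ_p}` is the Specht module of `λ_p`.
It is realised as a left ideal of `ℂW`: the tensor product is the left ideal of `ℂW_μ` generated by
the product of the Young symmetrizers of the `λ_p` and of the idempotent of the character, and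
inducing a left ideal `ℂW_μ e` gives `ℂW e`. -/
noncomputable def irrep (ε : rootsOfUnity ℓ ℂ) (lam : MultiPartition ℓ n) :
    Submodule (CW ℓ n) (CW ℓ n) :=
  Submodule.span (CW ℓ n) {rowSym lam * colAntisym lam * charIdem ε lam}

/-- `θ` is the scalar by which `eu0` acts on `𝔛_λ`. -/
def IsTheta (ε : rootsOfUnity ℓ ℂ) (h : ℂ) (H : Fin ℓ → ℂ)
    (lam : MultiPartition ℓ n) (θ : ℂ) : Prop :=
  ∀ v ∈ irrep ε lam, eu0 ε h H * v = θ • v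

/-- `Δ_{μ,h,H} ≺ Δ_{λ,h,H}`, i.e. `θ_μ - θ_λ` is a positive integer. -/
def StdLT (ε : rootsOfUnity ℓ ℂ) (h : ℂ) (H : Fin ℓ → ℂ)
    (mu lam : MultiPartition ℓ n) : Prop :=
  ∃ θmu θlam : ℂ, IsTheta ε h H mu θmu ∧ IsTheta ε h H lam θlam ∧
    ∃ k : ℕ, 0 < k ∧ θmu - θlam = k

/-- `Δ_{μ,h,H} ≼ Δ_{λ,h,H}`, the standard modules being indexed by `𝒫_n^ℓ`. -/
def StdLE (ε : rootsOfUnity ℓ ℂ) (h : ℂ) (H : Fin ℓ → ℂ)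
    (mu lam : MultiPartition ℓ n) : Prop :=
  mu = lam ∨ StdLT ε h H mu lam

/-- `ν^• = (ν_{ℓ-1}, …, ν_1, ν_ℓ)`. -/
def bullet (ν : Fin ℓ → ℕ) (p : Fin ℓ) : ℕ :=
  if hp : p.val + 1 < ℓ then ν ⟨ℓ - 2 - p.val, by omega⟩ else ν p

/-- `h_p = ν^•_p / κ - m / (ℓ κ)`. -/
noncomputable def paramH (ν : Fin ℓ → ℕ) (κ : ℂ) (p : Fin ℓ) : ℂ :=
  (bullet ν p : ℂ) / κ - (AffineO.size ν : ℂ) / ((ℓ : ℂ) * κ)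

end CRDAHA

/-! ### Centrality of `eu0` in the group algebra. -/

namespace CRDAHA

variable {ℓ n : ℕ}

/-! Both orders are controlled by one numerical function. On affine weights take the linear form
`grading`, which weighs δ by ℓ and every ε_j of the p-th block by -p. It is constant on blocks,
hence invariant under 𝔖_ν, and it takes positive integer values on the positive real roots outside
Π_ν⁺. One step x ↑ y subtracts from y a positive integer multiple of such a root and then permutes
within blocks, so it lowers the form by a positive integer (`Up.grading_sub_pos`). Along ⊴ the
weights are therefore equal, or the form drops by a positive integer.

On the other side `eu0` is central (`commute_eu0`), so its action on 𝔛_λ is read off from the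
generator, a Young symmetrizer times a character idempotent (`isTheta_theta`). The scalar is
explicit: contents come from the transpositions, and a linear function of the sizes |λ_p| comes from
the diagonal part.

The two computations meet in `exists_grading_add_theta_eq`: the form at the lifted highest weight of
λ plus θ_{λ°} does not depend on λ. The Casimir term in the δ-coordinate carries the same contents
with the opposite sign, and the choice of h, H, π and of the reversal λ° makes the terms linear in
|λ_p| cancel. Hence θ_{μ°} - θ_{λ°} is exactly the drop of the form from λ to μ. -/

theorem perm_mul (σ τ : Equiv.Perm (Fin n)) :
    (perm (σ * τ) : CW ℓ n) = perm σ * perm τ := by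
  simp only [perm, map_mul]

theorem diag_mul (d e : Fin n → rootsOfUnity ℓ ℂ) : diag (d * e) = diag d * diag e := by
  simp only [diag, map_mul]

theorem perm_mul_diag (σ : Equiv.Perm (Fin n)) (d : Fin n → rootsOfUnity ℓ ℂ) :
    perm σ * diag d = diag (fun k => d (σ⁻¹ k)) * perm σ := by
  simp only [perm, diag, ← map_mul]
  congr 1
  have h : (fun k => d (σ⁻¹ k)) =
      (mulAutArrow σ : MulAut (Fin n → rootsOfUnity ℓ ℂ)) d := rfl
  rw [h, SemidirectProduct.inl_aut, mul_assoc, ← map_mul, inv_mul_cancel, map_one, mul_one]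

theorem mulSingle_comp_inv (σ : Equiv.Perm (Fin n)) (i : Fin n) (ζ : rootsOfUnity ℓ ℂ) :
    (fun k => (Pi.mulSingle i ζ : Fin n → rootsOfUnity ℓ ℂ) (σ⁻¹ k)) = Pi.mulSingle (σ i) ζ := by
  funext k
  by_cases h : k = σ i
  · subst h; simp
  · have h' : σ⁻¹ k ≠ i := fun e => h (by rw [← e]; simp)
    rw [Pi.mulSingle_eq_of_ne h, Pi.mulSingle_eq_of_ne h']

noncomputable instance fintypeRootsOfUnity [NeZero ℓ] : Fintype (rootsOfUnity ℓ ℂ) :=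
  Fintype.ofFinite _

theorem pow_primitive_bijective [NeZero ℓ] {ε : rootsOfUnity ℓ ℂ} (hε : IsPrimitiveRoot ε ℓ) :
    Function.Bijective (fun a : Fin ℓ => ε ^ (a : ℕ)) := by
  refine (Fintype.bijective_iff_injective_and_card _).2 ⟨fun a b hab =>
    Fin.ext (hε.pow_inj a.2 b.2 hab), ?_⟩
  rw [Fintype.card_fin, ← Nat.card_eq_fintype_card, Complex.card_rootsOfUnity]

/-- The sum of the reflections `s_{i,j} ζ_i ζ_j⁻¹` over all `ℓ`-th roots of unity `ζ`. -/
noncomputable def reflSum [NeZero ℓ] (i j : Fin n) : CW ℓ n :=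
  ∑ ζ : rootsOfUnity ℓ ℂ, perm (Equiv.swap i j) * diag (Pi.mulSingle i ζ * Pi.mulSingle j ζ⁻¹)

theorem sum_pow_primitive [NeZero ℓ] {ε : rootsOfUnity ℓ ℂ} (hε : IsPrimitiveRoot ε ℓ)
    {M : Type*} [AddCommMonoid M] (f : rootsOfUnity ℓ ℂ → M) :
    ∑ a : Fin ℓ, f (ε ^ (a : ℕ)) = ∑ ζ, f ζ :=
  (pow_primitive_bijective hε).sum_comp f

theorem sum_refl [NeZero ℓ] {ε : rootsOfUnity ℓ ℂ} (hε : IsPrimitiveRoot ε ℓ) (i j : Fin n) :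
    ∑ p ∈ Finset.range ℓ, refl ε i j p = reflSum i j := by
  rw [Finset.sum_range, reflSum, ← sum_pow_primitive hε]
  rfl

theorem reflSum_comm [NeZero ℓ] (i j : Fin n) : (reflSum i j : CW ℓ n) = reflSum j i := by
  unfold reflSum
  rw [← Equiv.sum_comp (Equiv.inv (rootsOfUnity ℓ ℂ))]
  simp only [Equiv.inv_apply, inv_inv, Equiv.swap_comm i j]
  exact Finset.sum_congr rfl fun ζ _ => by rw [mul_comm (Pi.mulSingle i _)]

theorem perm_mul_reflSum [NeZero ℓ] (σ : Equiv.Perm (Fin n)) (i j : Fin n) :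
    (perm σ * reflSum i j : CW ℓ n) = reflSum (σ i) (σ j) * perm σ := by
  unfold reflSum
  rw [Finset.mul_sum, Finset.sum_mul]
  refine Finset.sum_congr rfl fun ζ _ => ?_
  have hs : σ * Equiv.swap i j = Equiv.swap (σ i) (σ j) * σ := by
    rw [Equiv.swap_apply_apply]; group
  have hd : perm σ * diag (Pi.mulSingle i ζ * Pi.mulSingle j ζ⁻¹) =
      diag (Pi.mulSingle (σ i) ζ * Pi.mulSingle (σ j) ζ⁻¹) * perm σ := by
    rw [diag_mul, ← mul_assoc, perm_mul_diag, mul_assoc, perm_mul_diag, ← mul_assoc,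
      mulSingle_comp_inv, mulSingle_comp_inv, ← diag_mul]
  rw [← mul_assoc, ← perm_mul, hs, perm_mul, mul_assoc, hd, mul_assoc]

/-- A diagonal element does not commute with a single reflection: moving it across replaces ζ by d_j
d_i⁻¹ ζ. Summing over all ζ absorbs this translation. -/
theorem diag_mul_reflSum [NeZero ℓ] (d : Fin n → rootsOfUnity ℓ ℂ) {i j : Fin n} (hij : i ≠ j) :
    diag d * reflSum i j = reflSum i j * diag d := by
  unfold reflSum
  rw [Finset.mul_sum, Finset.sum_mul]
  refine Fintype.sum_equiv (Equiv.mulLeft (d j * (d i)⁻¹)) _ _ fun ζ => ?_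
  have h1 : diag d * perm (Equiv.swap i j) =
      perm (Equiv.swap i j) * diag (fun k => d (Equiv.swap i j k)) := by
    rw [perm_mul_diag]; simp
  rw [← mul_assoc, h1, mul_assoc, mul_assoc, ← diag_mul, ← diag_mul]
  congr 2
  funext k
  simp only [Pi.mul_apply, Equiv.coe_mulLeft, Pi.mulSingle_apply]
  rcases eq_or_ne k i with rfl | hki
  · simp [hij, mul_comm]
    rw [mul_left_comm (d k), mul_left_comm (d k), mul_inv_cancel, mul_one]
  rcases eq_or_ne k j with rfl | hkj
  · simp [hki, mul_comm]
    rw [mul_left_comm (d k), mul_left_comm (d k), mul_inv_cancel, mul_one, mul_comm]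
  · simp [hki, hkj, Equiv.swap_apply_of_ne_of_ne hki hkj]

/-- The range i < j is not stable under 𝔖_n, while the range of ordered pairs is; this form makes
conjugation by a permutation a mere reindexing. -/
theorem sum_lt_eq_half {M : Type*} [AddCommGroup M] [Module ℂ M] (F : Fin n → Fin n → M)
    (hF : ∀ i j, F i j = F j i) :
    ∑ i, ∑ j with i < j, F i j = (1 / 2 : ℂ) • ∑ i, ∑ j with j ≠ i, F i j := by
  have h1 : ∑ i, ∑ j with j ≠ i, F i j =
      ∑ i, ∑ j with i < j, F i j + ∑ i, ∑ j with j < i, F i j := by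
    rw [← Finset.sum_add_distrib]
    refine Finset.sum_congr rfl fun i _ => ?_
    simp only [Finset.sum_filter, ← Finset.sum_add_distrib]
    refine Finset.sum_congr rfl fun j _ => ?_
    rcases lt_trichotomy i j with h | h | h
    · simp [h, h.ne', h.not_gt]
    · simp [h]
    · simp [h, h.ne, h.not_gt]
  have h2 : ∑ i, ∑ j with j < i, F i j = ∑ i, ∑ j with i < j, F i j := by
    simp only [Finset.sum_filter]
    rw [Finset.sum_comm]
    exact Finset.sum_congr rfl fun i _ => Finset.sum_congr rfl fun j _ => by rw [hF]
  rw [h1, h2, ← two_smul ℂ, smul_smul]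
  norm_num

/-- The part of `eu0` in the group algebra of the `i`-th factor of `(D_ℓ)^n`. -/
noncomputable def diagPart (ε : rootsOfUnity ℓ ℂ) (H : Fin ℓ → ℂ) (i : Fin n) : CW ℓ n :=
  ∑ p ∈ Finset.Icc 1 (ℓ - 1), ∑ p' ∈ Finset.Icc 1 (ℓ - 1),
    ((((ε : ℂˣ) : ℂ)⁻¹) ^ (p * p') * ∑ q : Fin ℓ with q.val < p', H q) •
      diag (Pi.mulSingle i (ε ^ p))

theorem eu0_eq [NeZero ℓ] {ε : rootsOfUnity ℓ ℂ} (hε : IsPrimitiveRoot ε ℓ) (h : ℂ)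
    (H : Fin ℓ → ℂ) :
    (eu0 ε h H : CW ℓ n) =
      (-h / 2) • ∑ i, ∑ j with j ≠ i, ((ℓ : ℂ) • 1 - reflSum i j) + ∑ i, diagPart ε H i := by
  have h1 : ∀ i j : Fin n, ∑ p ∈ Finset.range ℓ, (1 - refl ε i j p) =
      (ℓ : ℂ) • 1 - reflSum i j := fun i j => by
    rw [Finset.sum_sub_distrib, sum_refl hε, Finset.sum_const, Finset.card_range,
      ← Nat.cast_smul_eq_nsmul ℂ]
  unfold eu0 diagPart
  simp only [h1]
  rw [sum_lt_eq_half _ (fun i j => by rw [reflSum_comm]), smul_smul]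
  congr 2
  ring

theorem perm_mul_diagPart (ε : rootsOfUnity ℓ ℂ) (H : Fin ℓ → ℂ) (σ : Equiv.Perm (Fin n))
    (i : Fin n) : perm σ * diagPart ε H i = diagPart ε H (σ i) * perm σ := by
  simp only [diagPart, Finset.mul_sum, Finset.sum_mul, mul_smul_comm, smul_mul_assoc,
    perm_mul_diag, mulSingle_comp_inv]

theorem diag_mul_diagPart (ε : rootsOfUnity ℓ ℂ) (H : Fin ℓ → ℂ) (d : Fin n → rootsOfUnity ℓ ℂ)
    (i : Fin n) : diag d * diagPart ε H i = diagPart ε H i * diag d := by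
  simp only [diagPart, Finset.mul_sum, Finset.sum_mul, mul_smul_comm, smul_mul_assoc,
    ← diag_mul, mul_comm d]

theorem perm_commute_eu0 [NeZero ℓ] {ε : rootsOfUnity ℓ ℂ} (hε : IsPrimitiveRoot ε ℓ) (h : ℂ)
    (H : Fin ℓ → ℂ) (σ : Equiv.Perm (Fin n)) : Commute (perm σ) (eu0 ε h H) := by
  rw [commute_iff_eq, eu0_eq hε, mul_add, add_mul, mul_smul_comm, smul_mul_assoc]
  refine congrArg₂ (· + ·) (congrArg _ ?_) ?_
  · simp only [Finset.sum_filter, Finset.mul_sum, Finset.sum_mul, mul_ite, ite_mul, mul_zero,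
      zero_mul, mul_sub, sub_mul, perm_mul_reflSum, mul_smul_comm, smul_mul_assoc, mul_one,
      one_mul]
    rw [← Equiv.sum_comp σ (fun i => ∑ j, if j ≠ i then
      (ℓ : ℂ) • perm σ - reflSum i j * perm σ else 0)]
    refine Finset.sum_congr rfl fun i _ => ?_
    rw [← Equiv.sum_comp σ (fun j => if j ≠ σ i then
      (ℓ : ℂ) • perm σ - reflSum (σ i) j * perm σ else 0)]
    simp
  · simp only [Finset.mul_sum, Finset.sum_mul, perm_mul_diagPart]
    exact Equiv.sum_comp σ (fun i => diagPart ε H i * perm σ)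

theorem diag_commute_eu0 [NeZero ℓ] {ε : rootsOfUnity ℓ ℂ} (hε : IsPrimitiveRoot ε ℓ) (h : ℂ)
    (H : Fin ℓ → ℂ) (d : Fin n → rootsOfUnity ℓ ℂ) : Commute (diag d) (eu0 ε h H) := by
  rw [commute_iff_eq, eu0_eq hε, mul_add, add_mul, mul_smul_comm, smul_mul_assoc]
  refine congrArg₂ (· + ·) (congrArg _ ?_) ?_
  · simp only [Finset.mul_sum, Finset.sum_mul]
    refine Finset.sum_congr rfl fun i _ => Finset.sum_congr rfl fun j hj => ?_
    rw [mul_sub, sub_mul, diag_mul_reflSum d (Finset.mem_filter.1 hj).2.symm, mul_smul_comm,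
      smul_mul_assoc, mul_one, one_mul]
  · simp only [Finset.mul_sum, Finset.sum_mul, diag_mul_diagPart]

theorem commute_eu0 [NeZero ℓ] {ε : rootsOfUnity ℓ ℂ} (hε : IsPrimitiveRoot ε ℓ) (h : ℂ)
    (H : Fin ℓ → ℂ) (x : CW ℓ n) : Commute x (eu0 ε h H) := by
  induction x using MonoidAlgebra.induction_on with
  | of g =>
    have hg : MonoidAlgebra.of ℂ (W ℓ n) g = diag g.left * perm g.right := by
      rw [diag, perm, ← map_mul, SemidirectProduct.inl_left_mul_inr_right]
    rw [hg]
    exact (diag_commute_eu0 hε h H _).mul_left (perm_commute_eu0 hε h H _)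
  | add f g hf hg => exact hf.add_left hg
  | smul r f hf => exact hf.smul_left r

/-! ### The idempotent of the character -/

/-- The component of the box containing `k`. -/
noncomputable def comp (lam : MultiPartition ℓ n) (k : Fin n) : Fin ℓ := (lam.tableau k).1

/-- Indexing by the roots of unity themselves, instead of exponents of ε, turns multiplication by a
diagonal element into a translation of the index set. -/
theorem charIdem_eq [NeZero ℓ] {ε : rootsOfUnity ℓ ℂ} (hε : IsPrimitiveRoot ε ℓ)
    (lam : MultiPartition ℓ n) :
    charIdem ε lam = ((ℓ : ℂ) ^ n)⁻¹ • ∑ d : Fin n → rootsOfUnity ℓ ℂ,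
      (∏ k, (((d k : ℂˣ) : ℂ)⁻¹) ^ (comp lam k : ℕ)) • diag d := by
  unfold charIdem
  congr 1
  rw [← Equiv.sum_comp (Equiv.arrowCongr (Equiv.refl (Fin n)) (Equiv.ofBijective _ (pow_primitive_bijective hε)))]
  refine Finset.sum_congr rfl fun a _ => ?_
  congr 1
  refine Finset.prod_congr rfl fun k _ => ?_
  simp [comp, pow_mul]

theorem diag_mul_charIdem [NeZero ℓ] {ε : rootsOfUnity ℓ ℂ} (hε : IsPrimitiveRoot ε ℓ)
    (lam : MultiPartition ℓ n) (d : Fin n → rootsOfUnity ℓ ℂ) :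
    diag d * charIdem ε lam = (∏ k, ((d k : ℂˣ) : ℂ) ^ (comp lam k : ℕ)) • charIdem ε lam := by
  rw [charIdem_eq hε, mul_smul_comm, smul_comm]
  congr 1
  rw [Finset.mul_sum, Finset.smul_sum]
  refine Fintype.sum_equiv (Equiv.mulLeft d) _ _ fun e => ?_
  rw [mul_smul_comm, ← diag_mul, smul_smul, ← Finset.prod_mul_distrib]
  congr 1
  refine Finset.prod_congr rfl fun k _ => ?_
  have : (((d k : ℂˣ) : ℂ)) ≠ 0 := Units.ne_zero _
  simp only [Equiv.coe_mulLeft, Pi.mul_apply, Subgroup.coe_mul, Units.val_mul, ← mul_pow]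
  congr 1
  field_simp

theorem diag_mulSingle_mul_charIdem [NeZero ℓ] {ε : rootsOfUnity ℓ ℂ} (hε : IsPrimitiveRoot ε ℓ)
    (lam : MultiPartition ℓ n) (i : Fin n) (ζ : rootsOfUnity ℓ ℂ) :
    diag (Pi.mulSingle i ζ) * charIdem ε lam =
      (((ζ : ℂˣ) : ℂ) ^ (comp lam i : ℕ)) • charIdem ε lam := by
  rw [diag_mul_charIdem hε, Finset.prod_eq_single i]
  · simp
  · intro k _ hk; simp [hk]
  · simp

theorem sum_pow_of_pow_eq_one {x : ℂ} (hx : x ^ ℓ = 1) :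
    ∑ p ∈ Finset.range ℓ, x ^ p = if x = 1 then (ℓ : ℂ) else 0 := by
  split_ifs with h
  · simp [h]
  · have := mul_geom_sum x ℓ
    rw [hx, sub_self] at this
    exact (mul_eq_zero.1 this).resolve_left (sub_ne_zero.2 h)

theorem coe_isPrimitiveRoot {ε : rootsOfUnity ℓ ℂ} (hε : IsPrimitiveRoot ε ℓ) :
    IsPrimitiveRoot ((ε : ℂˣ) : ℂ) ℓ :=
  IsPrimitiveRoot.coe_units_iff.2 (IsPrimitiveRoot.coe_submonoidClass_iff.2 hε)

theorem sum_pow_mul_inv_pow {z : ℂ} (hz : IsPrimitiveRoot z ℓ) {a b : ℕ} (ha : a < ℓ)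
    (hb : b < ℓ) :
    ∑ p ∈ Finset.range ℓ, (z ^ p) ^ a * ((z ^ p)⁻¹) ^ b = if a = b then (ℓ : ℂ) else 0 := by
  have hz0 : z ≠ 0 := hz.ne_zero (by omega)
  have h1 : ∀ p, (z ^ p) ^ a * ((z ^ p)⁻¹) ^ b = (z ^ a * (z ^ b)⁻¹) ^ p := fun p => by
    rw [mul_pow, inv_pow, inv_pow, ← pow_mul, ← pow_mul, ← pow_mul, ← pow_mul, mul_comm a,
      mul_comm b]
  have h2 : (z ^ a * (z ^ b)⁻¹) ^ ℓ = 1 := by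
    rw [mul_pow, inv_pow, ← pow_mul, ← pow_mul, mul_comm a, mul_comm b, pow_mul, pow_mul,
      hz.pow_eq_one]
    simp
  simp only [h1]
  rw [sum_pow_of_pow_eq_one h2]
  have h3 : z ^ a * (z ^ b)⁻¹ = 1 ↔ a = b := by
    rw [mul_inv_eq_one₀ (pow_ne_zero _ hz0)]
    exact ⟨fun e => hz.pow_inj ha hb e, fun e => by rw [e]⟩
  simp only [h3]

/-- Orthogonality of characters: ζ_i ζ_j⁻¹ acts by ζ to the difference of the two components, and
the sum over ζ kills this unless the components agree. -/
theorem reflSum_mul_charIdem [NeZero ℓ] {ε : rootsOfUnity ℓ ℂ} (hε : IsPrimitiveRoot ε ℓ)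
    (lam : MultiPartition ℓ n) (i j : Fin n) :
    reflSum i j * charIdem ε lam =
      (if comp lam i = comp lam j then (ℓ : ℂ) else 0) •
        (perm (Equiv.swap i j) * charIdem ε lam) := by
  rw [reflSum, Finset.sum_mul]
  simp only [diag_mul, mul_assoc, diag_mulSingle_mul_charIdem hε, mul_smul_comm, smul_smul]
  rw [← Finset.sum_smul, ← sum_pow_primitive hε]
  congr 1
  have := sum_pow_mul_inv_pow (coe_isPrimitiveRoot hε) (comp lam i).2 (comp lam j).2
  rw [Finset.sum_range] at this
  simp only [Fin.ext_iff, ← this]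
  refine Finset.sum_congr rfl fun p _ => ?_
  simp [mul_comm]

/-- The eigenvalue of the diagonal part of `eu0` on the `q`-th character. -/
noncomputable def diagValue (H : Fin ℓ → ℂ) (q : ℕ) : ℂ :=
  (ℓ : ℂ) * ∑ r : Fin ℓ with r.val < q, H r -
    ∑ p' ∈ Finset.Icc 1 (ℓ - 1), ∑ r : Fin ℓ with r.val < p', H r

theorem diagPart_mul_charIdem [NeZero ℓ] {ε : rootsOfUnity ℓ ℂ} (hε : IsPrimitiveRoot ε ℓ)
    (H : Fin ℓ → ℂ) (lam : MultiPartition ℓ n) (i : Fin n) :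
    diagPart ε H i * charIdem ε lam = diagValue H (comp lam i) • charIdem ε lam := by
  have hz := coe_isPrimitiveRoot hε
  set z : ℂ := ((ε : ℂˣ) : ℂ) with hzdef
  set q : ℕ := (comp lam i : ℕ) with hq
  have hqlt : q < ℓ := (comp lam i).2
  simp only [diagPart, Finset.sum_mul, smul_mul_assoc, diag_mulSingle_mul_charIdem hε, smul_smul]
  simp only [← Finset.sum_smul]
  congr 1
  rw [Finset.sum_comm]
  have hℓ : 0 < ℓ := Nat.pos_of_ne_zero (NeZero.ne ℓ)
  have hr : ∀ f : ℕ → ℂ, ∑ p ∈ Finset.range ℓ, f p = f 0 + ∑ p ∈ Finset.Icc 1 (ℓ - 1), f p := by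
    intro f
    have : Finset.Icc 1 (ℓ - 1) = Finset.Ico 1 ℓ := by ext; simp; omega
    rw [this, Finset.range_eq_Ico, Finset.sum_eq_sum_Ico_succ_bot hℓ]
  have h1 : ∀ p' ∈ Finset.Icc 1 (ℓ - 1), ∑ p ∈ Finset.Icc 1 (ℓ - 1),
      (z⁻¹ ^ (p * p') * ∑ r : Fin ℓ with r.val < p', H r) *
        (((ε ^ p : rootsOfUnity ℓ ℂ) : ℂˣ) : ℂ) ^ q =
      ((if q = p' then (ℓ : ℂ) else 0) - 1) * ∑ r : Fin ℓ with r.val < p', H r := by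
    -- The full sum over p is ℓ or 0 by orthogonality; `eu0` omits p = 0, whence the -1.
    intro p' hp'
    have hp'lt : p' < ℓ := by have := Finset.mem_Icc.1 hp'; omega
    have h2 := sum_pow_mul_inv_pow hz hqlt hp'lt
    rw [hr] at h2
    simp only [pow_zero, one_pow, inv_one, mul_one] at h2
    rw [← h2, add_sub_cancel_left, Finset.sum_mul]
    refine Finset.sum_congr rfl fun p _ => ?_
    simp only [SubmonoidClass.coe_pow, Units.val_pow_eq_pow_val, ← hzdef, pow_mul, inv_pow]
    ring
  rw [Finset.sum_congr rfl h1]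
  simp only [sub_mul, one_mul, ite_mul, zero_mul, Finset.sum_sub_distrib, diagValue]
  congr 1
  rw [Finset.sum_ite_eq]
  split_ifs with h
  · rfl
  -- The value q = 0 lies outside the range of p', but there the partial sum of the parameters is
  -- empty.
  · have : q = 0 := by
      by_contra h0
      exact h (Finset.mem_Icc.2 (by omega))
    simp [this]

/-! ### Young symmetrizers and the class sum of transpositions -/

/-- The row of the box containing `k`. -/
noncomputable def row (lam : MultiPartition ℓ n) (k : Fin n) : ℕ := (lam.tableau k).2.1.1

/-- The column of the box containing `k`. -/
noncomputable def col (lam : MultiPartition ℓ n) (k : Fin n) : ℕ := (lam.tableau k).2.1.2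

theorem tableau_ext (lam : MultiPartition ℓ n) {i j : Fin n} (h0 : comp lam i = comp lam j)
    (h1 : row lam i = row lam j) (h2 : col lam i = col lam j) : i = j := by
  apply lam.tableau.injective
  unfold comp row col at *
  revert h0 h1 h2
  generalize lam.tableau i = x
  generalize lam.tableau j = y
  obtain ⟨p, ⟨a, b⟩, hx⟩ := x
  obtain ⟨q, ⟨c, d⟩, hy⟩ := y
  rintro rfl h1 h2
  simp only at h1 h2
  subst h1 h2
  rfl

theorem exists_tableau_eq (lam : MultiPartition ℓ n) {p : Fin ℓ} {a b : ℕ}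
    (h : (a, b) ∈ lam.parts p) : ∃ k, comp lam k = p ∧ row lam k = a ∧ col lam k = b := by
  refine ⟨lam.tableau.symm ⟨p, (a, b), h⟩, ?_⟩
  unfold comp row col
  rw [Equiv.apply_symm_apply]
  exact ⟨rfl, rfl, rfl⟩

theorem cell_mem (lam : MultiPartition ℓ n) (k : Fin n) :
    (row lam k, col lam k) ∈ lam.parts (comp lam k) := (lam.tableau k).2.2

theorem rowSym_mul_perm (lam : MultiPartition ℓ n) {τ : Equiv.Perm (Fin n)}
    (hτ : ∀ k, comp lam (τ k) = comp lam k ∧ row lam (τ k) = row lam k) :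
    rowSym lam * perm τ = rowSym lam := by
  unfold rowSym
  simp only [Finset.sum_mul, ← perm_mul, Finset.sum_filter, ite_mul, zero_mul]
  refine Fintype.sum_equiv (Equiv.mulRight τ) _ _ fun σ => ?_
  refine if_congr ⟨fun h k => ?_, fun h k => ?_⟩ rfl rfl
  · exact ⟨(h (τ k)).1.trans (hτ k).1, (h (τ k)).2.trans (hτ k).2⟩
  · obtain ⟨k, rfl⟩ := τ.surjective k
    exact ⟨(h k).1.trans (hτ k).1.symm, (h k).2.trans (hτ k).2.symm⟩

theorem perm_mul_colAntisym (lam : MultiPartition ℓ n) {τ : Equiv.Perm (Fin n)}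
    (hτ : ∀ k, comp lam (τ k) = comp lam k ∧ col lam (τ k) = col lam k) :
    perm τ * colAntisym lam = ((Equiv.Perm.sign τ : ℤ) : ℂ) • colAntisym lam := by
  unfold colAntisym
  simp only [Finset.mul_sum, Finset.smul_sum, ← perm_mul, Finset.sum_filter, mul_ite, mul_zero,
    smul_ite, smul_zero, mul_smul_comm]
  refine Fintype.sum_equiv (Equiv.mulLeft τ) _ _ fun σ => ?_
  refine if_congr ⟨fun h k => ?_, fun h k => ?_⟩ ?_ rfl
  · exact ⟨(hτ (σ k)).1.trans (h k).1, (hτ (σ k)).2.trans (h k).2⟩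
  · exact ⟨(hτ (σ k)).1.symm.trans (h k).1, (hτ (σ k)).2.symm.trans (h k).2⟩
  · rw [smul_smul]
    congr 1
    simp only [Equiv.coe_mulLeft, Equiv.Perm.sign_mul]
    rcases Int.units_eq_one_or (Equiv.Perm.sign τ) with h | h <;> simp [h]

theorem swap_preserves {α : Type*} (f : Fin n → α) {x y : Fin n} (h : f x = f y) (k : Fin n) :
    f (Equiv.swap x y k) = f k := by
  rcases eq_or_ne k x with rfl | hx
  · simp [h]
  rcases eq_or_ne k y with rfl | hy
  · simp [h]
  rw [Equiv.swap_apply_of_ne_of_ne hx hy]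

theorem swap_mul_colAntisym (lam : MultiPartition ℓ n) {x y : Fin n} (hxy : x ≠ y)
    (h0 : comp lam x = comp lam y) (h1 : col lam x = col lam y) :
    perm (Equiv.swap x y) * colAntisym lam = -colAntisym lam := by
  rw [perm_mul_colAntisym lam fun k => ⟨swap_preserves _ h0 k, swap_preserves _ h1 k⟩,
    Equiv.Perm.sign_swap hxy]
  simp

theorem rowSym_mul_swap (lam : MultiPartition ℓ n) {x y : Fin n}
    (h0 : comp lam x = comp lam y) (h1 : row lam x = row lam y) :
    rowSym lam * perm (Equiv.swap x y) = rowSym lam :=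
  rowSym_mul_perm lam fun k => ⟨swap_preserves _ h0 k, swap_preserves _ h1 k⟩

/-- If `g` carries two boxes of one row to one column, then `a g b = 0`. -/
theorem rowSym_mul_perm_mul_colAntisym_eq_zero (lam : MultiPartition ℓ n)
    {g : Equiv.Perm (Fin n)} {x y : Fin n} (hxy : x ≠ y)
    (h0 : comp lam x = comp lam y) (h1 : row lam x = row lam y)
    (h2 : comp lam (g⁻¹ x) = comp lam (g⁻¹ y)) (h3 : col lam (g⁻¹ x) = col lam (g⁻¹ y)) :
    rowSym lam * perm g * colAntisym lam = 0 := by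
  -- With a, b the row and column sums and g⁻¹x, g⁻¹y in one column: a g b = a (x y) g b = a g (g⁻¹x
  -- g⁻¹y) b = -a g b.
  have hg : Equiv.swap x y * g = g * Equiv.swap (g⁻¹ x) (g⁻¹ y) := by
    rw [Equiv.swap_apply_apply]; group
  have h : rowSym lam * perm g * colAntisym lam = -(rowSym lam * perm g * colAntisym lam) := by
    conv_lhs => rw [← rowSym_mul_swap lam h0 h1]
    rw [mul_assoc (rowSym lam), ← perm_mul, hg, perm_mul, mul_assoc, mul_assoc,
      swap_mul_colAntisym lam (fun e => hxy (g⁻¹.injective e)) h2 h3, mul_neg, mul_neg, mul_assoc]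
  have h2' : (2 : ℂ) • (rowSym lam * perm g * colAntisym lam) = 0 := by
    rw [two_smul]; nth_rewrite 2 [h]; rw [add_neg_cancel]
  exact (smul_eq_zero.1 h2').resolve_left two_ne_zero

theorem rowSym_mul_swap_mul_colAntisym_of_row_lt (lam : MultiPartition ℓ n) {i j : Fin n}
    (h0 : comp lam i = comp lam j) (h1 : row lam i < row lam j) (h2 : col lam i ≠ col lam j) :
    rowSym lam * perm (Equiv.swap i j) * colAntisym lam = 0 := by
  -- The corner y in the row of i and the column of j is a box of the diagram. The swap sends i to j
  -- and fixes y, so two boxes of one row land in one column.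
  have hmem : (row lam i, col lam j) ∈ lam.parts (comp lam j) :=
    (lam.parts (comp lam j)).up_left_mem h1.le le_rfl (cell_mem lam j)
  obtain ⟨y, hy0, hy1, hy2⟩ := exists_tableau_eq lam hmem
  have hiy : i ≠ y := fun e => h2 (by rw [e, hy2])
  have hjy : y ≠ j := fun e => h1.ne (by rw [← hy1, e])
  apply rowSym_mul_perm_mul_colAntisym_eq_zero lam hiy (h0.trans hy0.symm) hy1.symm
  · rw [Equiv.swap_inv, Equiv.swap_apply_left, Equiv.swap_apply_of_ne_of_ne hiy.symm hjy, hy0]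
  · rw [Equiv.swap_inv, Equiv.swap_apply_left, Equiv.swap_apply_of_ne_of_ne hiy.symm hjy, hy2]

theorem rowSym_mul_swap_mul_colAntisym (lam : MultiPartition ℓ n) {i j : Fin n} (hij : i ≠ j)
    (h0 : comp lam i = comp lam j) :
    rowSym lam * perm (Equiv.swap i j) * colAntisym lam =
      ((if row lam i = row lam j then 1 else 0) - (if col lam i = col lam j then 1 else 0) : ℂ) •
        (rowSym lam * colAntisym lam) := by
  by_cases h1 : row lam i = row lam j
  · have h2 : col lam i ≠ col lam j := fun h2 => hij (tableau_ext lam h0 h1 h2)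
    simp [h1, h2, rowSym_mul_swap lam h0 h1]
  by_cases h2 : col lam i = col lam j
  · rw [mul_assoc, swap_mul_colAntisym lam hij h0 h2]
    simp [h1, h2]
  simp only [h1, h2, if_false, sub_self, zero_smul]
  rcases Nat.lt_or_gt_of_ne h1 with h | h
  · exact rowSym_mul_swap_mul_colAntisym_of_row_lt lam h0 h h2
  · rw [Equiv.swap_comm]
    exact rowSym_mul_swap_mul_colAntisym_of_row_lt lam h0.symm h (Ne.symm h2)

/-- The sum of the transpositions of entries in the same component, each counted twice. -/
noncomputable def swapSum (lam : MultiPartition ℓ n) : CW ℓ n :=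
  ∑ i, ∑ j with j ≠ i, if comp lam i = comp lam j then perm (Equiv.swap i j) else 0

theorem perm_mul_swapSum (lam : MultiPartition ℓ n) {τ : Equiv.Perm (Fin n)}
    (hτ : ∀ k, comp lam (τ k) = comp lam k) :
    perm τ * swapSum lam = swapSum lam * perm τ := by
  unfold swapSum
  simp only [Finset.sum_filter, Finset.mul_sum, Finset.sum_mul, mul_ite, ite_mul, mul_zero,
    zero_mul, ← perm_mul]
  refine Fintype.sum_equiv τ _ _ fun i => Fintype.sum_equiv τ _ _ fun j => ?_
  have hs : τ * Equiv.swap i j = Equiv.swap (τ i) (τ j) * τ := by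
    rw [Equiv.swap_apply_apply]; group
  rw [hτ, hτ, hs]
  simp

/-- This moves `swapSum` between the row and column sums, where each transposition can be evaluated
separately. -/
theorem colAntisym_mul_swapSum (lam : MultiPartition ℓ n) :
    colAntisym lam * swapSum lam = swapSum lam * colAntisym lam := by
  unfold colAntisym
  simp only [Finset.sum_mul, Finset.mul_sum, smul_mul_assoc, mul_smul_comm]
  refine Finset.sum_congr rfl fun σ hσ => ?_
  rw [perm_mul_swapSum lam fun k => ((Finset.mem_filter.1 hσ).2 k).1]

/-- Twice the sum of the contents of the boxes of `λ`. -/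
noncomputable def twiceContent (lam : MultiPartition ℓ n) : ℂ :=
  ∑ p, ∑ c ∈ (lam.parts p).cells, ((lam.parts p).rowLen c.1 - (lam.parts p).colLen c.2 : ℂ)

theorem sum_boxes (lam : MultiPartition ℓ n) (f : Fin ℓ → ℕ → ℕ → ℂ) :
    ∑ k, f (comp lam k) (row lam k) (col lam k) =
      ∑ p, ∑ c ∈ (lam.parts p).cells, f p c.1 c.2 := by
  have := Equiv.sum_comp lam.tableau (fun b : lam.Box => f b.1 b.2.1.1 b.2.1.2)
  refine Eq.trans this ?_
  rw [Fintype.sum_sigma]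
  refine Finset.sum_congr rfl fun p _ => ?_
  exact Finset.sum_coe_sort (lam.parts p).cells (fun c => f p c.1 c.2)

theorem sum_same_row (lam : MultiPartition ℓ n) (i : Fin n) :
    ∑ j, (if comp lam i = comp lam j ∧ row lam i = row lam j then 1 else 0 : ℂ) =
      (lam.parts (comp lam i)).rowLen (row lam i) := by
  rw [sum_boxes lam (fun p a _ => if comp lam i = p ∧ row lam i = a then (1 : ℂ) else 0),
    Finset.sum_eq_single (comp lam i)]
  · rw [YoungDiagram.rowLen_eq_card, YoungDiagram.row]
    simp [eq_comm]
  · intro p _ hp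
    simp [hp.symm]
  · simp

theorem sum_same_col (lam : MultiPartition ℓ n) (i : Fin n) :
    ∑ j, (if comp lam i = comp lam j ∧ col lam i = col lam j then 1 else 0 : ℂ) =
      (lam.parts (comp lam i)).colLen (col lam i) := by
  rw [sum_boxes lam (fun p _ b => if comp lam i = p ∧ col lam i = b then (1 : ℂ) else 0),
    Finset.sum_eq_single (comp lam i)]
  · rw [YoungDiagram.colLen_eq_card, YoungDiagram.col]
    simp [eq_comm]
  · intro p _ hp
    simp [hp.symm]
  · simp

theorem rowSym_mul_swapSum_mul_colAntisym (lam : MultiPartition ℓ n) :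
    rowSym lam * swapSum lam * colAntisym lam =
      twiceContent lam • (rowSym lam * colAntisym lam) := by
  have h1 : rowSym lam * swapSum lam * colAntisym lam =
      ∑ i, ∑ j, ((if comp lam i = comp lam j ∧ row lam i = row lam j then 1 else 0) -
        (if comp lam i = comp lam j ∧ col lam i = col lam j then 1 else 0) : ℂ) •
          (rowSym lam * colAntisym lam) := by
    unfold swapSum
    simp only [Finset.sum_filter, Finset.mul_sum, Finset.sum_mul]
    refine Finset.sum_congr rfl fun i _ => Finset.sum_congr rfl fun j _ => ?_
    by_cases hij : j = i
    -- The terms with i = j can be added freely: row and column indicators cancel.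
    · simp [hij]
    by_cases h0 : comp lam i = comp lam j
    · simp only [hij, h0, ne_eq, not_false_eq_true, if_true, true_and]
      exact rowSym_mul_swap_mul_colAntisym lam (Ne.symm hij) h0
    · simp [h0]
  rw [h1]
  simp only [← Finset.sum_smul, Finset.sum_sub_distrib, sum_same_row, sum_same_col]
  congr 1
  rw [← Finset.sum_sub_distrib]
  exact sum_boxes lam (fun p a b => ((lam.parts p).rowLen a - (lam.parts p).colLen b : ℂ))

/-! ### The scalar `θ` -/

/-- The scalar by which `eu0` acts on `𝔛_λ`. -/
noncomputable def theta (h : ℂ) (H : Fin ℓ → ℂ) (lam : MultiPartition ℓ n) : ℂ :=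
  -h / 2 * (ℓ * (n * (n - 1)) - ℓ * twiceContent lam) +
    ∑ p, ((lam.parts p).card : ℂ) * diagValue H p

theorem sum_ne_one (c : ℂ) : ∑ i : Fin n, ∑ j : Fin n with j ≠ i, c = n * (n - 1) * c := by
  have : ∀ i : Fin n, ∑ j : Fin n with j ≠ i, c = (n - 1) * c := fun i => by
    rw [Finset.sum_const, Finset.filter_ne', Finset.card_erase_of_mem (Finset.mem_univ i),
      Finset.card_univ, Fintype.card_fin, nsmul_eq_mul,
      Nat.cast_sub (Nat.one_le_iff_ne_zero.2 (by have := i.2; omega)), Nat.cast_one]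
  simp only [this, Finset.sum_const, Finset.card_univ, Fintype.card_fin, nsmul_eq_mul]
  ring

theorem eu0_mul_charIdem [NeZero ℓ] {ε : rootsOfUnity ℓ ℂ} (hε : IsPrimitiveRoot ε ℓ) (h : ℂ)
    (H : Fin ℓ → ℂ) (lam : MultiPartition ℓ n) :
    eu0 ε h H * charIdem ε lam =
      ((-h / 2 * (ℓ * (n * (n - 1))) + ∑ p, ((lam.parts p).card : ℂ) * diagValue H p) • 1 +
        (h / 2 * ℓ) • swapSum lam) * charIdem ε lam := by
  have h1 : ∑ i, diagPart ε H i * charIdem ε lam =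
      (∑ p, ((lam.parts p).card : ℂ) * diagValue H p) • charIdem ε lam := by
    simp only [diagPart_mul_charIdem hε, ← Finset.sum_smul]
    rw [sum_boxes lam (fun p _ _ => diagValue H p)]
    simp [YoungDiagram.card]
  have h2 : ∑ i, ∑ j with j ≠ i, ((ℓ : ℂ) • 1 - reflSum i j) * charIdem ε lam =
      (ℓ * (n * (n - 1)) : ℂ) • charIdem ε lam -
        (ℓ : ℂ) • (swapSum lam * charIdem ε lam) := by
    simp only [sub_mul, Finset.sum_sub_distrib, smul_mul_assoc, one_mul, reflSum_mul_charIdem hε,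
      swapSum, Finset.sum_mul, Finset.smul_sum, ite_mul, zero_mul, smul_ite, smul_zero, ite_smul,
      zero_smul]
    congr 1
    simp only [← Finset.sum_smul]
    rw [sum_ne_one]
    ring_nf
  rw [eu0_eq hε, add_mul, smul_mul_assoc, Finset.sum_mul, Finset.sum_mul, h1]
  simp only [Finset.sum_mul, h2]
  simp only [add_mul, smul_mul_assoc, one_mul, add_smul, smul_sub, smul_smul]
  module

/-- By centrality `eu0` can be moved next to the character idempotent, where it becomes a scalar
plus a multiple of `swapSum`; the Young symmetrizer then turns `swapSum` into twice the content sum.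
-/
theorem isTheta_theta [NeZero ℓ] {ε : rootsOfUnity ℓ ℂ} (hε : IsPrimitiveRoot ε ℓ) (h : ℂ)
    (H : Fin ℓ → ℂ) (lam : MultiPartition ℓ n) : IsTheta ε h H lam (theta h H lam) := by
  intro v hv
  obtain ⟨x, rfl⟩ := Submodule.mem_span_singleton.1 hv
  have key : eu0 ε h H * (rowSym lam * colAntisym lam * charIdem ε lam) =
      theta h H lam • (rowSym lam * colAntisym lam * charIdem ε lam) := by
    rw [← mul_assoc, ← (commute_eu0 hε h H (rowSym lam * colAntisym lam)).eq, mul_assoc,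
      eu0_mul_charIdem hε, ← mul_assoc]
    have : rowSym lam * colAntisym lam * swapSum lam =
        twiceContent lam • (rowSym lam * colAntisym lam) := by
      rw [mul_assoc, colAntisym_mul_swapSum, ← mul_assoc, rowSym_mul_swapSum_mul_colAntisym]
    rw [mul_add, mul_smul_comm, mul_smul_comm, mul_one, this, smul_smul, ← add_smul,
      smul_mul_assoc, theta]
    congr 1
    ring
  rw [smul_eq_mul, ← mul_assoc, ← (commute_eu0 hε h H x).eq, mul_assoc, key, mul_smul_comm]

end CRDAHA

namespace AffineO

variable {ℓ : ℕ} {ν : Fin ℓ → ℕ}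

/-! ### A linear form that increases along `↑` -/

/-- The linear form `ℓ ω₀ - ∑_p p ∑_{j ∈ J_p} ε_j`, paired with `x`. -/
def grading (x : AffWt ν) : ℂ := ℓ * x.1 - ∑ j, ((j.1 : ℕ) + 1 : ℂ) * x.2.1 j

theorem grading_add (x y : AffWt ν) : grading (x + y) = grading x + grading y := by
  simp only [grading, Prod.fst_add, Prod.snd_add, Pi.add_apply, mul_add, Finset.sum_add_distrib]
  ring

theorem grading_sub (x y : AffWt ν) : grading (x - y) = grading x - grading y := by
  simp only [grading, Prod.fst_sub, Prod.snd_sub, Pi.sub_apply, mul_sub, Finset.sum_sub_distrib]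
  ring

theorem grading_smul (a : ℂ) (x : AffWt ν) : grading (a • x) = a * grading x := by
  simp only [grading, Prod.smul_fst, Prod.smul_snd, Pi.smul_apply, smul_eq_mul, mul_sub,
    Finset.mul_sum]
  congr 1
  · ring
  · exact Finset.sum_congr rfl fun j _ => by ring

theorem grading_permute {w : Equiv.Perm (J ν)} (hw : w ∈ leviWeyl ν) (x : AffWt ν) :
    grading (permute w x) = grading x := by
  simp only [grading, permute]
  congr 1
  refine (Fintype.sum_equiv w _ _ fun j => ?_).symm
  rw [hw j, Equiv.symm_apply_apply]

theorem grading_dotPermute {w : Equiv.Perm (J ν)} (hw : w ∈ leviWeyl ν) (x : AffWt ν) :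
    grading (dotPermute w x) = grading x := by
  rw [dotPermute, grading_sub, grading_permute hw, grading_add, add_sub_cancel_right]

theorem grading_dotReflect (α x : AffWt ν) :
    grading (dotReflect α x) = grading x - form (x + rhoHat ν) α * grading α := by
  rw [dotReflect, reflect, grading_sub, grading_sub, grading_smul, grading_add]
  ring

theorem grading_rootVec (i j : J ν) (k : ℤ) :
    grading (rootVec i j k) = ((ℓ * k + j.1 - i.1 : ℤ) : ℂ) := by
  simp only [grading, rootVec, Pi.sub_apply, mul_sub, Finset.sum_sub_distrib, Pi.single_apply,
    mul_ite, mul_one, mul_zero, Finset.sum_ite_eq', Finset.mem_univ, if_true]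
  push_cast
  ring

theorem sum_lt_add_le {p q : Fin ℓ} (h : p < q) :
    (∑ r with r < p, ν r) + ν p ≤ ∑ r with r < q, ν r := by
  rw [add_comm, ← Finset.sum_insert (by simp)]
  refine Finset.sum_le_sum_of_subset fun r hr => ?_
  simp only [Finset.mem_insert, Finset.mem_filter, Finset.mem_univ, true_and] at hr ⊢
  rcases hr with rfl | hr
  · exact h
  · exact hr.trans h

theorem block_le_of_pos_lt {i j : J ν} (h : pos i < pos j) : i.1 ≤ j.1 := by
  by_contra hlt
  have h1 := sum_lt_add_le (ν := ν) (not_le.1 hlt)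
  have h2 := j.2.2
  unfold pos at h
  omega

theorem grading_pos_of_mem {α : AffWt ν} (h : α ∈ posRealRoots ν \ leviPosRoots ν) :
    ∃ k : ℕ, 0 < k ∧ grading α = k := by
  obtain ⟨⟨i, j, k, -, hk, rfl⟩, hlevi⟩ := h
  have hpos : 0 < (ℓ * k + j.1 - i.1 : ℤ) := by
    have hi : ((i.1 : ℕ) : ℤ) < ℓ := by exact_mod_cast i.1.2
    -- Block indices differ by at most ℓ - 1, so the weight ℓ of δ wins when k > 0. When k = 0,
    -- excluding Π_ν⁺ forces the two blocks to differ.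
    rcases hk with hk | ⟨rfl, hk⟩
    · have : (ℓ : ℤ) * 1 ≤ ℓ * k := mul_le_mul_of_nonneg_left hk (by positivity)
      omega
    · have h1 : i.1 < j.1 := lt_of_le_of_ne (block_le_of_pos_lt hk) fun e =>
        hlevi ⟨i, j, hk, e, rfl⟩
      have : ((i.1 : ℕ) : ℤ) < (j.1 : ℕ) := by exact_mod_cast h1
      omega
  obtain ⟨m, hm⟩ := Int.eq_ofNat_of_zero_le hpos.le
  refine ⟨m, by omega, ?_⟩
  rw [grading_rootVec, hm]
  simp

theorem Up.grading_sub_pos {x y : AffWt ν} (h : Up x y) :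
    ∃ k : ℕ, 0 < k ∧ grading y - grading x = k := by
  obtain ⟨-, -, α, hα, ⟨N, hN, hform⟩, -, ⟨-, w, hw, rfl⟩, -⟩ := h
  obtain ⟨k, hk, hgr⟩ := grading_pos_of_mem hα
  -- The reflection subtracts N α, with N the integral pairing and k the value of the form on α.
  refine ⟨N * k, Nat.mul_pos hN hk, ?_⟩
  rw [grading_dotPermute hw, grading_dotReflect, hform, hgr]
  push_cast
  ring

theorem TriLE.eq_or_grading_sub_pos {x y : AffWt ν} (h : TriLE x y) :
    x = y ∨ ∃ k : ℕ, 0 < k ∧ grading y - grading x = k := by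
  induction h with
  | refl => exact Or.inl rfl
  | tail _ hup ih =>
    obtain ⟨k, hk, e⟩ := Up.grading_sub_pos hup
    rcases ih with rfl | ⟨k', hk', e'⟩
    · exact Or.inr ⟨k, hk, e⟩
    · refine Or.inr ⟨k' + k, by omega, ?_⟩
      push_cast
      rw [← e, ← e']
      ring

/-- The weight records only the first ν_p rows of the p-th diagram; the length bound makes all later
rows empty. -/
theorem toWeight_injective {n : ℕ} {lam mu : MultiPartition ℓ n} (hlam : lam.LengthLE ν)
    (hmu : mu.LengthLE ν) (h : toWeight ν lam = toWeight ν mu) : lam = mu := by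
  have hparts : lam.parts = mu.parts := by
    funext p
    have hrow : ∀ i, (lam.parts p).rowLen i = (mu.parts p).rowLen i := by
      intro i
      by_cases hi : i < ν p
      · have := congrFun h ⟨p, i, hi⟩
        simpa [toWeight] using this
      · have hzero : ∀ Y : YoungDiagram, Y.colLen 0 ≤ ν p → Y.rowLen i = 0 := by
          intro Y hY
          by_contra h0
          have h1 := YoungDiagram.mem_iff_lt_rowLen.2 (Nat.pos_of_ne_zero h0)
          have h2 := YoungDiagram.mem_iff_lt_colLen.1 h1
          omega
        rw [hzero _ (hlam p), hzero _ (hmu p)]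
    apply YoungDiagram.ext
    ext ⟨a, b⟩
    rw [YoungDiagram.mem_cells, YoungDiagram.mem_cells, YoungDiagram.mem_iff_lt_rowLen,
      YoungDiagram.mem_iff_lt_rowLen, hrow]
  cases lam
  cases mu
  simpa using hparts

end AffineO

/-! ### Sums over the boxes of a Young diagram -/

namespace YoungDiagram

theorem sum_cells_by_rows (Y : YoungDiagram) {N : ℕ} (hN : Y.colLen 0 ≤ N) (f : ℕ × ℕ → ℂ) :
    ∑ c ∈ Y.cells, f c = ∑ i ∈ Finset.range N, ∑ j ∈ Finset.range (Y.rowLen i), f (i, j) := by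
  rw [Finset.sum_sigma']
  refine Finset.sum_nbij' (fun c => ⟨c.1, c.2⟩) (fun s => (s.1, s.2)) ?_ ?_ ?_ ?_ ?_
  · rintro ⟨i, j⟩ h
    have h0 : (i, 0) ∈ Y := Y.up_left_mem le_rfl (Nat.zero_le j) ((mem_cells _).1 h)
    exact Finset.mem_sigma.2 ⟨Finset.mem_range.2 ((mem_iff_lt_colLen.1 h0).trans_le hN),
      Finset.mem_range.2 (mem_iff_lt_rowLen.1 ((mem_cells _).1 h))⟩
  · rintro ⟨i, j⟩ h
    exact (mem_cells _).2 (mem_iff_lt_rowLen.2 (Finset.mem_range.1 (Finset.mem_sigma.1 h).2))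
  all_goals simp

theorem sum_cells_by_cols (Y : YoungDiagram) (f : ℕ × ℕ → ℂ) :
    ∑ c ∈ Y.cells, f c =
      ∑ j ∈ Finset.range (Y.rowLen 0), ∑ i ∈ Finset.range (Y.colLen j), f (i, j) := by
  rw [Finset.sum_sigma']
  refine Finset.sum_nbij' (fun c => ⟨c.2, c.1⟩) (fun s => (s.2, s.1)) ?_ ?_ ?_ ?_ ?_
  · rintro ⟨i, j⟩ h
    have h0 : (0, j) ∈ Y := Y.up_left_mem (Nat.zero_le i) le_rfl ((mem_cells _).1 h)
    exact Finset.mem_sigma.2 ⟨Finset.mem_range.2 (mem_iff_lt_rowLen.1 h0),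
      Finset.mem_range.2 (mem_iff_lt_colLen.1 ((mem_cells _).1 h))⟩
  · rintro ⟨j, i⟩ h
    exact (mem_cells _).2 (mem_iff_lt_colLen.2 (Finset.mem_range.1 (Finset.mem_sigma.1 h).2))
  all_goals simp

theorem sum_rowLen (Y : YoungDiagram) {N : ℕ} (hN : Y.colLen 0 ≤ N) :
    ∑ i : Fin N, (Y.rowLen i : ℂ) = Y.card := by
  have h := Y.sum_cells_by_rows hN (fun _ => 1)
  rw [Finset.sum_range] at h
  simpa [YoungDiagram.card] using h.symm

/-- As L² is the sum of the first L odd numbers, summing column lengths over all boxes amounts to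
summing 2i + 1, where i is the row index from 0. -/
theorem sum_rowLen_mul (Y : YoungDiagram) {N : ℕ} (hN : Y.colLen 0 ≤ N) :
    ∑ i : Fin N, (Y.rowLen i : ℂ) * (Y.rowLen i - 2 * i - 1) =
      ∑ c ∈ Y.cells, (Y.rowLen c.1 - Y.colLen c.2 : ℂ) := by
  have hodd : ∀ L : ℕ, ∑ i ∈ Finset.range L, (2 * i + 1 : ℂ) = L * L := by
    intro L
    induction L with
    | zero => simp
    | succ L ih => rw [Finset.sum_range_succ, ih]; push_cast; ring
  have hcol : ∑ c ∈ Y.cells, (Y.colLen c.2 : ℂ) = ∑ c ∈ Y.cells, (2 * c.1 + 1 : ℂ) := by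
    rw [sum_cells_by_cols, sum_cells_by_cols]
    refine Finset.sum_congr rfl fun j _ => ?_
    simp [hodd]
  rw [Finset.sum_sub_distrib, hcol, ← Finset.sum_sub_distrib, Y.sum_cells_by_rows hN,
    Finset.sum_range]
  refine Finset.sum_congr rfl fun i _ => ?_
  simp only [Finset.sum_const, Finset.card_range, nsmul_eq_mul]
  ring

end YoungDiagram

/-! ### Comparison of the two gradings -/

namespace CRDAHA

open AffineO

variable {ℓ n : ℕ}

/-- The substitution r ↦ ℓ - 2 - r undoes the reversal in ν^•, leaving the ν_s from position p up to
the last but one. -/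
theorem sum_bullet [NeZero ℓ] (ν : Fin ℓ → ℕ) (p : Fin ℓ) :
    ∑ r : Fin ℓ with r.val < (p.rev : ℕ), (bullet ν r : ℂ) =
      (size ν : ℂ) - ((∑ q with q < p, ν q : ℕ) : ℂ) -
        ν ⟨ℓ - 1, Nat.sub_one_lt (NeZero.ne ℓ)⟩ := by
  have hℓ := NeZero.ne ℓ
  have h1 : ∑ r : Fin ℓ with r.val < (p.rev : ℕ), bullet ν r =
      ∑ s : Fin ℓ with p ≤ s ∧ s.val < ℓ - 1, ν s := by
    refine Finset.sum_nbij' (fun r => ⟨ℓ - 2 - r.val, by omega⟩)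
      (fun s => ⟨ℓ - 2 - s.val, by omega⟩) ?_ ?_ ?_ ?_ ?_
    · intro r hr
      simp only [Finset.mem_filter, Finset.mem_univ, true_and, Fin.val_rev, Fin.le_def] at hr ⊢
      omega
    · intro s hs
      simp only [Finset.mem_filter, Finset.mem_univ, true_and, Fin.val_rev, Fin.le_def] at hs ⊢
      omega
    · intro r hr
      simp only [Finset.mem_filter, Finset.mem_univ, true_and, Fin.val_rev] at hr
      ext
      simp only
      omega
    · intro s hs
      simp only [Finset.mem_filter, Finset.mem_univ, true_and] at hs
      ext
      simp only
      omega
    · intro r hr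
      simp only [Finset.mem_filter, Finset.mem_univ, true_and, Fin.val_rev] at hr
      exact dif_pos (by omega)
  have h2 : size ν = (∑ q with q < p, ν q) + (∑ s : Fin ℓ with p ≤ s ∧ s.val < ℓ - 1, ν s) +
      ν ⟨ℓ - 1, Nat.sub_one_lt (NeZero.ne ℓ)⟩ := by
    have h3 : ν ⟨ℓ - 1, Nat.sub_one_lt (NeZero.ne ℓ)⟩ =
        ∑ s, if s = ⟨ℓ - 1, Nat.sub_one_lt (NeZero.ne ℓ)⟩ then ν s else 0 := by simp
    rw [h3, Finset.sum_filter, Finset.sum_filter, ← Finset.sum_add_distrib,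
      ← Finset.sum_add_distrib]
    refine Finset.sum_congr rfl fun s _ => ?_
    have := s.2
    have := p.2
    simp only [Fin.lt_def, Fin.le_def, Fin.ext_iff]
    split_ifs <;> omega
  rw [← Nat.cast_sum, h1, h2]
  push_cast
  ring

theorem sum_paramH [NeZero ℓ] (ν : Fin ℓ → ℕ) (κ : ℂ) (p : Fin ℓ) :
    ∑ r : Fin ℓ with r.val < (p.rev : ℕ), paramH ν κ r =
      ((size ν : ℂ) - ((∑ q with q < p, ν q : ℕ) : ℂ) -
        ν ⟨ℓ - 1, Nat.sub_one_lt (NeZero.ne ℓ)⟩) / κ -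
        ((ℓ : ℂ) - ((p : ℕ) + 1)) * (size ν / (ℓ * κ)) := by
  have hcard : ((Finset.univ.filter fun r : Fin ℓ => r.val < (p.rev : ℕ)).card : ℂ) =
      (ℓ : ℂ) - ((p : ℕ) + 1) := by
    have : (Finset.univ.filter fun r : Fin ℓ => r.val < (p.rev : ℕ)) = Finset.Iio p.rev := by
      ext r
      simp [Fin.lt_def]
    rw [this, Fin.card_Iio, Fin.val_rev, Nat.cast_sub p.2]
    push_cast
    ring
  simp only [paramH]
  rw [Finset.sum_sub_distrib, ← Finset.sum_div, sum_bullet, Finset.sum_const, nsmul_eq_mul, hcard]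

theorem theta_rev (h : ℂ) (H : Fin ℓ → ℂ) (lam : MultiPartition ℓ n) :
    theta h H lam.rev = -h / 2 * (ℓ * (n * (n - 1)) - ℓ * twiceContent lam) +
      ∑ p, ((lam.parts p).card : ℂ) * diagValue H p.rev := by
  have h1 : twiceContent lam.rev = twiceContent lam :=
    Equiv.sum_comp Fin.revPerm (fun p => ∑ c ∈ (lam.parts p).cells,
      ((lam.parts p).rowLen c.1 - (lam.parts p).colLen c.2 : ℂ))
  have h2 : ∑ p, ((lam.rev.parts p).card : ℂ) * diagValue H p =
      ∑ p, ((lam.parts p).card : ℂ) * diagValue H p.rev := by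
    rw [← Equiv.sum_comp Fin.revPerm]
    simp [MultiPartition.rev]
  rw [theta, h1, h2]

variable {ν : Fin ℓ → ℕ}

theorem sum_toWeight_block {lam : MultiPartition ℓ n} (hlam : lam.LengthLE ν) (f : Fin ℓ → ℂ) :
    ∑ j : J ν, f j.1 * toWeight ν lam j = ∑ p, f p * ((lam.parts p).card : ℂ) := by
  rw [Fintype.sum_sigma]
  refine Finset.sum_congr rfl fun p _ => ?_
  rw [← (lam.parts p).sum_rowLen (hlam p), Finset.mul_sum]
  rfl

/-- On row i (from 0) of block p, ρ equals m - N_p - i, with N_p the total size of the earlier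
blocks. So λ(2ρ + λ) splits into λ(λ - 2i - 1), which sums to twice the contents, and a multiple of
λ depending only on p. -/
theorem sum_toWeight_casimir {lam : MultiPartition ℓ n} (hlam : lam.LengthLE ν) :
    ∑ j : J ν, toWeight ν lam j * (2 * rho ν j + toWeight ν lam j) = twiceContent lam +
      ∑ p, (1 + 2 * size ν - 2 * ((∑ q with q < p, ν q : ℕ) : ℂ)) * ((lam.parts p).card : ℂ) := by
  rw [← sum_toWeight_block hlam, twiceContent, Fintype.sum_sigma, Fintype.sum_sigma,
    ← Finset.sum_add_distrib]
  refine Finset.sum_congr rfl fun p _ => ?_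
  rw [← (lam.parts p).sum_rowLen_mul (hlam p), ← Finset.sum_add_distrib]
  refine Finset.sum_congr rfl fun i _ => ?_
  simp only [toWeight, rho, pos]
  push_cast
  ring

/-- The bracket is the coefficient of |λ_p| in the Casimir term, including the cross term with π.
Since c = κ - m, that cross term gives -(p + 1) + (p + 1)m/κ; the summand p + 1 removes the first
part, and the -m/(ℓκ) in h_p supplies the second. -/
theorem exists_diagValue_rev_eq [NeZero ℓ] (ν : Fin ℓ → ℕ) {κ : ℂ} (hκ : κ ≠ 0) :
    ∃ D : ℂ, ∀ p : Fin ℓ, diagValue (paramH ν κ) p.rev =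
      ((p : ℕ) + 1 : ℂ) +
        ℓ / (2 * κ) * (1 + 2 * size ν - 2 * ((∑ q with q < p, ν q : ℕ) : ℂ) +
          2 * (level ν κ / ℓ * -((p : ℕ) + 1 : ℂ))) + D := by
  have hℓ : (ℓ : ℂ) ≠ 0 := Nat.cast_ne_zero.2 (NeZero.ne ℓ)
  refine ⟨-(ℓ / (2 * κ)) - ℓ * ν ⟨ℓ - 1, Nat.sub_one_lt (NeZero.ne ℓ)⟩ / κ - ℓ * size ν / κ -
    ∑ p' ∈ Finset.Icc 1 (ℓ - 1), ∑ r : Fin ℓ with r.val < p', paramH ν κ r, fun p => ?_⟩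
  rw [diagValue, sum_paramH, level]
  generalize ((∑ q with q < p, ν q : ℕ) : ℂ) = N
  generalize (∑ p' ∈ Finset.Icc 1 (ℓ - 1), ∑ r : Fin ℓ with r.val < p', paramH ν κ r) = G
  field_simp
  ring

/-- Up to a constant, `θ_{λ°}` is minus the grading of the highest weight attached to `λ`. -/
theorem exists_grading_add_theta_eq [NeZero ℓ] (ν : Fin ℓ → ℕ) {κ : ℂ} (hκ : κ ≠ 0) :
    ∃ C : ℂ, ∀ lam : MultiPartition ℓ n, lam.LengthLE ν →
      grading (tilde ν κ (toWeight ν lam + shift ν κ)) +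
        theta (1 / κ) (paramH ν κ) lam.rev = C := by
  obtain ⟨D, hD⟩ := exists_diagValue_rev_eq ν hκ
  -- The constant gathers what depends only on π, n, ν and κ; the term D n uses that the sizes |λ_p|
  -- add up to n.
  refine ⟨-(ℓ / (2 * κ)) * (∑ j, shift ν κ j * (2 * rho ν j + shift ν κ j)) -
    ∑ j : J ν, ((j.1 : ℕ) + 1 : ℂ) * shift ν κ j - ℓ * (n * (n - 1)) / (2 * κ) + D * n,
    fun lam hlam => ?_⟩
  set A : Fin ℓ → ℂ := fun p => ((lam.parts p).card : ℂ) with hA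
  set N : Fin ℓ → ℂ := fun p => ((∑ q with q < p, ν q : ℕ) : ℂ) with hN
  have hn : ∑ p, A p = n := by
    rw [← lam.card_eq, hA]
    push_cast
    rfl
  have hcas : ∑ j, (toWeight ν lam + shift ν κ) j *
      (2 * rho ν j + (toWeight ν lam + shift ν κ) j) =
      twiceContent lam + ∑ p, (1 + 2 * size ν - 2 * N p) * A p +
        ∑ p : Fin ℓ, (2 * (level ν κ / ℓ * -((p : ℕ) + 1 : ℂ))) * A p +
          ∑ j, shift ν κ j * (2 * rho ν j + shift ν κ j) := by
    rw [← sum_toWeight_casimir hlam, ← sum_toWeight_block hlam, ← Finset.sum_add_distrib,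
      ← Finset.sum_add_distrib]
    refine Finset.sum_congr rfl fun j _ => ?_
    simp only [Pi.add_apply, shift]
    ring
  have hblock : ∑ j : J ν, ((j.1 : ℕ) + 1 : ℂ) * (toWeight ν lam + shift ν κ) j =
      ∑ p : Fin ℓ, ((p : ℕ) + 1 : ℂ) * A p + ∑ j : J ν, ((j.1 : ℕ) + 1 : ℂ) * shift ν κ j := by
    rw [← sum_toWeight_block hlam (fun p => ((p : ℕ) + 1 : ℂ)), ← Finset.sum_add_distrib]
    exact Finset.sum_congr rfl fun j _ => by rw [Pi.add_apply, mul_add]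
  have hdiag : ∑ p : Fin ℓ, A p * diagValue (paramH ν κ) p.rev =
      ∑ p : Fin ℓ, ((p : ℕ) + 1 : ℂ) * A p +
        ℓ / (2 * κ) * (∑ p, (1 + 2 * size ν - 2 * N p) * A p +
          ∑ p : Fin ℓ, (2 * (level ν κ / ℓ * -((p : ℕ) + 1 : ℂ))) * A p) + D * n := by
    rw [← hn, ← Finset.sum_add_distrib, Finset.mul_sum, Finset.mul_sum,
      ← Finset.sum_add_distrib, ← Finset.sum_add_distrib]
    refine Finset.sum_congr rfl fun p _ => ?_
    rw [hD]
    ring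
  rw [theta_rev, hdiag]
  simp only [grading, tilde]
  rw [hcas, hblock]
  -- The contents enter with coefficient -ℓ/(2κ) from the δ-coordinate and +ℓ/(2κ) from θ.
  field_simp
  ring

end CRDAHA

/-! ### Comparison of the two orders. -/

theorem proposition6p4 {ℓ n : ℕ} [NeZero ℓ] (ν : Fin ℓ → ℕ) (hm : 0 < ∑ p, ν p)
    (ε : rootsOfUnity ℓ ℂ) (hε : IsPrimitiveRoot ε ℓ)
    (κ : ℂ) (hκ : ∀ q : ℚ, 0 ≤ q → κ ≠ (q : ℂ))
    (lam mu : MultiPartition ℓ n) (hlam : lam.LengthLE ν) (hmu : mu.LengthLE ν)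
    (hle : AffineO.StdLE ν κ mu lam) :
    CRDAHA.StdLE ε (1 / κ) (CRDAHA.paramH ν κ) mu.rev lam.rev := by
  have hκ0 : κ ≠ 0 := by simpa using hκ 0 le_rfl
  rcases AffineO.TriLE.eq_or_grading_sub_pos hle with h | ⟨k, hk, h⟩
  · have h1 : AffineO.toWeight ν mu + AffineO.shift ν κ =
        AffineO.toWeight ν lam + AffineO.shift ν κ := congrArg (fun x => x.2.1) h
    exact Or.inl (by rw [AffineO.toWeight_injective hmu hlam (add_right_cancel h1)])
  · obtain ⟨C, hC⟩ := CRDAHA.exists_grading_add_theta_eq (n := n) ν hκ0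
    refine Or.inr ⟨_, _, CRDAHA.isTheta_theta hε _ _ _, CRDAHA.isTheta_theta hε _ _ _, k, hk, ?_⟩
    rw [← h]
    linear_combination hC mu hmu - hC lam hlam
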